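/- Let $T$ be a locally compact Hausdorff space with a bounded Radon measure $\mu$, let $\mathscr A$ and $\mathscr B$ be unital $C^*$-algebras with units denoted by $I$, and let $1<r\le 2$. Let $a:T\to\mathbb R$ be a bounded continuous nonnegative function with $\int_T a(t)^{\frac1{1-r}}\,d\mu(t)<\infty$, where $0^{\frac1{1-r}}=\infty$ (so that $a>0$ $\mu$-almost everywhere). Let $(\phi_t)_{t\in T}$ be a field of positive linear maps $\phi_t:\mathscr A\to\mathscr B$ such that $t\mapsto a(t)^{\frac1{1-r}}\phi_t(I)$ is Bochner integrable and $$\int_T a(t)^{\frac1{1-r}}\phi_t(I)\,d\mu(t)\le\left(\int_T a(t)^{\frac1{1-r}}\,d\mu(t)\right) I .$$ Then for every norm-continuous field $(A_t)_{t\in T}$ of positive elements of $\mathscr A$ such that $t\mapsto\phi_t(A_t)$ is strongly $\mu$-measurable and $t\mapsto a(t)\phi_t(A_t^r)$ is Bochner integrable, the function $t\mapsto\phi_t(A_t)$ is Bochner integrable and $$\left(\int_T\phi_t(A_t)\,d\mu(t)\right)^{r}\le\left(\int_T a(t)^{\frac1{1-r}}\,d\mu(t)\right)^{r-1}\int_T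 a(t)\,\phi_t(A_t^r)\,d\mu(t).$$ -/

import Mathlib

open MeasureTheory
open scoped ENNReal

/-! The proof integrates an operator tangent to `x ^ r`. Only the total mass `∫ a ^ q • φ t 1`, with
`q = 1 / (1 - r)`, is controlled, so a Jensen inequality for each `φ t` is not enough. What is
needed is one affine minorant `S (φ X) - R (φ 1) ≤ φ (X ^ r)` serving all positive maps at once:
`exists_tangent_rpow`.

For `1 < r < 2`, `x ^ r` is an integral over `t` of `t ^ (r - 2) * (x ^ 2 / (t + x))`, and `x ^ 2 /
(t + x)` is the maximum over `e` of `2 * e * x - e ^ 2 * (t + x)`. The operator form of this bound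
follows from `PositiveLinearMap.mul_cfc_add_cfc_mul_le`; taking `E = Y / (t + Y)` and integrating
over `t` gives a tangent at `Y`.

In the theorem, `Y` is the mean `w⁻¹ • J`. The tangent is applied to rescaled `A t`, weighted by `a
t ^ q` and integrated over `T`. -/

/-! ### Positive maps on the functional calculus of one element -/

section PositiveMap

variable {𝒜 : Type*} [CStarAlgebra 𝒜] [PartialOrder 𝒜] [StarOrderedRing 𝒜]
  {ℬ : Type*} [CStarAlgebra ℬ] [PartialOrder ℬ] [StarOrderedRing ℬ]

open Filter Topology unitInterval

/-- The spectrum of a nonnegative element lies between zero and the norm. -/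
lemma mem_Icc_norm_of_mem_spectrum {a : 𝒜} (ha : 0 ≤ a) {x : ℝ} (hx : x ∈ spectrum ℝ a) :
    x ∈ Set.Icc 0 ‖a‖ := by
  rcases subsingleton_or_nontrivial 𝒜 with h | h
  · simp [spectrum.of_subsingleton] at hx
  · exact ⟨spectrum_nonneg_of_nonneg ha hx,
      (le_abs_self x).trans (by simpa using spectrum.norm_le_norm_mul_of_mem hx)⟩

/-- A positive semidefinite real `2 × 2` matrix paired with a positive element and conjugated by
the column `(1, -E)` is positive. -/
lemma smul_mul_add_mul_le_of_sq_le_mul {P E : ℬ} (hP : 0 ≤ P) (hE : IsSelfAdjoint E)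
    {a b c : ℝ} (ha : 0 ≤ a) (hc : 0 ≤ c) (h : b ^ 2 ≤ a * c) :
    b • (E * P + P * E) ≤ a • P + c • (E * P * E) := by
  rcases hc.eq_or_lt with rfl | hc
  · have hb : b = 0 := by simpa using h
    simpa [hb] using smul_nonneg ha hP
  · have h1 : 0 ≤ (a - b ^ 2 / c) • P :=
      smul_nonneg (sub_nonneg.2 ((div_le_iff₀ hc).2 h)) hP
    have hS : IsSelfAdjoint (E - (b / c) • (1 : ℬ)) :=
      hE.sub ((IsSelfAdjoint.all _).smul (IsSelfAdjoint.one ℬ))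
    have h2 : 0 ≤ c • ((E - (b / c) • 1) * P * (E - (b / c) • 1)) :=
      smul_nonneg hc.le (hS.conjugate_nonneg hP)
    rw [← sub_nonneg]
    convert add_nonneg h1 h2 using 1
    simp only [sub_mul, mul_sub, smul_mul_assoc, mul_smul_comm, one_mul, mul_one, smul_sub,
      smul_smul, sub_smul, smul_add]
    have e1 : c * (b / c) = b := by field_simp
    have e2 : c * (b / c * (b / c)) = b ^ 2 / c := by field_simp
    rw [e1, e2]
    abel

/-- On the functional calculus of a single positive element a positive map is `2`-positive. -/
theorem PositiveLinearMap.mul_cfc_add_cfc_mul_le (φ : 𝒜 →ₚ[ℂ] ℬ) {X : 𝒜} (hX : 0 ≤ X)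
    {E : ℬ} (hE : IsSelfAdjoint E) {f g h : ℝ → ℝ}
    (hf : ContinuousOn f (Set.Ici 0)) (hg : ContinuousOn g (Set.Ici 0))
    (hh : ContinuousOn h (Set.Ici 0)) (hf0 : ∀ x, 0 ≤ x → 0 ≤ f x) (hh0 : ∀ x, 0 ≤ x → 0 ≤ h x)
    (hgfh : ∀ x, 0 ≤ x → g x ^ 2 ≤ f x * h x) :
    E * φ (cfc g X) + φ (cfc g X) * E ≤ φ (cfc f X) + E * φ (cfc h X) * E := by
  have hXs : IsSelfAdjoint X := .of_nonneg hX
  -- Rescaling by `M` puts the spectrum in the unit interval; the `+ 1` allows `X = 0`.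
  set M : ℝ := ‖X‖ + 1
  have hM : 0 < M := by positivity
  have hspec : ∀ x ∈ spectrum ℝ X, 0 ≤ x ∧ x ≤ M := fun x hx =>
    have h := mem_Icc_norm_of_mem_spectrum hX hx
    ⟨h.1, h.2.trans (by simp [M])⟩
  let ι : C(spectrum ℝ X, I) := ⟨fun x => ⟨x / M, div_nonneg (hspec x x.2).1 hM.le,
    (div_le_one hM).2 (hspec x x.2).2⟩, by fun_prop⟩
  let L : C(I, ℝ) → ℬ := fun u => φ (cfcHom hXs (u.comp ι))
  have hLc : Continuous L := (map_continuous φ).comp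
    ((cfcHom_continuous hXs).comp (ContinuousMap.continuous_precomp ι))
  have hL0 : ∀ u : C(I, ℝ), 0 ≤ u → 0 ≤ L u := fun u hu =>
    φ.map_nonneg ((cfcHom_nonneg_iff hXs).2 fun x => hu _)
  -- Bernstein sums approximate `φ (cfc u X)` with positive coefficients `L (bernstein n k)` that do
  -- not depend on `u`, so the claim reduces to a scalar condition at each node.
  have key : ∀ u : ℝ → ℝ, ContinuousOn u (Set.Ici 0) →
      Tendsto (fun n : ℕ => ∑ k : Fin (n + 1), u (M * bernstein.z k) • L (bernstein n k))
        atTop (𝓝 (φ (cfc u X))) := by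
    intro u hu
    let v : C(I, ℝ) := ⟨fun x => u (M * x), hu.comp_continuous (by fun_prop)
      fun x => mul_nonneg hM.le x.2.1⟩
    have hv : L v = φ (cfc u X) := by
      rw [cfc_apply u X hXs (hu.mono fun x hx => (hspec x hx).1)]
      simp only [L]
      congr 2
      ext x
      simp [v, ι, mul_div_cancel₀ _ hM.ne']
    rw [← hv]
    refine ((hLc.tendsto v).comp (bernsteinApproximation_uniform v)).congr fun n => ?_
    have : bernsteinApproximation n v =
        ∑ k : Fin (n + 1), (v (bernstein.z k)) • bernstein n k := by
      ext x
      simp [bernsteinApproximation.apply, mul_comm]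
    have hs : ∀ k : Fin (n + 1), L (v (bernstein.z k) • bernstein n k) =
        v (bernstein.z k) • L (bernstein n k) := fun k => by
      simp only [L]
      rw [ContinuousMap.smul_comp, map_smul, PositiveLinearMap.map_smul_of_tower]
    simp only [Function.comp_apply, this]
    have hsum : L (∑ k : Fin (n + 1), v (bernstein.z k) • bernstein n k) =
        ∑ k : Fin (n + 1), L (v (bernstein.z k) • bernstein n k) := by
      simp only [L]
      rw [← map_sum, ← map_sum]
      congr 2
      ext x
      simp
    rw [hsum]
    exact Finset.sum_congr rfl fun k _ => hs k
  refine le_of_tendsto_of_tendsto' (((key g hg).const_mul E).add ((key g hg).mul_const E))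
    ((key f hf).add (((key h hh).const_mul E).mul_const E)) fun n => ?_
  simp only [Finset.mul_sum, Finset.sum_mul, ← Finset.sum_add_distrib]
  refine Finset.sum_le_sum fun k _ => ?_
  have hz : 0 ≤ M * (bernstein.z k : ℝ) := mul_nonneg hM.le (bernstein.z k).2.1
  have := smul_mul_add_mul_le_of_sq_le_mul (hL0 (bernstein n k) fun x => bernstein_nonneg) hE
    (hf0 _ hz) (hh0 _ hz) (hgfh _ hz)
  simpa [smul_add] using this

end PositiveMap

/-! ### Powers and their integral representation -/

section Power

open Set Real CFC

variable {A : Type*} [CStarAlgebra A] [PartialOrder A] [StarOrderedRing A]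

/-- Homogeneity of nonnegative powers. -/
lemma CFC.smul_rpow_of_nonneg {a : A} (ha : 0 ≤ a) {c p : ℝ} (hc : 0 ≤ c) (hp : 0 ≤ p) :
    (c • a) ^ p = c ^ p • a ^ p := by
  have hcont : Continuous fun x : ℝ => x ^ p := Real.continuous_rpow_const hp
  rw [CFC.rpow_eq_cfc_real (smul_nonneg hc ha), CFC.rpow_eq_cfc_real ha,
    ← cfc_comp_const_mul c (fun x : ℝ => x ^ p) a hcont.continuousOn,
    ← cfc_const_mul (c ^ p) (fun x : ℝ => x ^ p) a hcont.continuousOn]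
  refine cfc_congr fun x hx => ?_
  exact Real.mul_rpow hc (spectrum_nonneg_of_nonneg ha hx)

lemma Real.rpowIntegrand₁₂_eq_rpow_mul_div {p t x : ℝ} (ht : 0 < t) (hx : 0 ≤ x) :
    rpowIntegrand₁₂ p t x = t ^ (p - 2) * (x ^ 2 / (t + x)) := by
  have : t ^ (p - 1) = t ^ (p - 2) * t := by
    rw [← Real.rpow_add_one ht.ne']; congr 1; ring
  have h : t + x ≠ 0 := by positivity
  rw [rpowIntegrand₁₂, this]
  field_simp
  ring

/-- The integral representation of `x ^ p`, `1 < p < 2`, passes to the functional calculus. -/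
lemma CFC.rpow_eq_setIntegral_cfc_rpowIntegrand₁₂ {p : ℝ} (hp : p ∈ Ioo 1 2) {ν : Measure ℝ}
    (hν : ∀ x ∈ Ici (0 : ℝ), IntegrableOn (fun t => rpowIntegrand₁₂ p t x) (Ioi 0) ν ∧
      x ^ p = ∫ t in Ioi 0, rpowIntegrand₁₂ p t x ∂ν) {a : A} (ha : 0 ≤ a) :
    IntegrableOn (fun t => cfc (rpowIntegrand₁₂ p t) a) (Ioi 0) ν ∧
      a ^ p = ∫ t in Ioi 0, cfc (rpowIntegrand₁₂ p t) a ∂ν := by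
  have hspec : ∀ x ∈ spectrum ℝ a, 0 ≤ x ∧ x ≤ ‖a‖ := fun x hx =>
    mem_Icc_norm_of_mem_spectrum ha hx
  have hcont : ContinuousOn (Function.uncurry (rpowIntegrand₁₂ p))
      (Ioi (0 : ℝ) ×ˢ spectrum ℝ a) :=
    continuousOn_rpowIntegrand₁₂_uncurry hp.1 _ fun x hx => (hspec x hx).1
  have hbound : ∀ᵐ t ∂ν.restrict (Ioi 0), ∀ z ∈ spectrum ℝ a,
      ‖rpowIntegrand₁₂ p t z‖ ≤ rpowIntegrand₁₂ p t ‖a‖ := by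
    filter_upwards [ae_restrict_mem measurableSet_Ioi] with t ht z hz
    rw [Real.norm_of_nonneg (rpowIntegrand₁₂_nonneg hp.1 (le_of_lt ht) (hspec z hz).1)]
    exact monotoneOn_rpowIntegrand₁₂ hp ht (hspec z hz).1 (norm_nonneg a) (hspec z hz).2
  have hfin := (hν ‖a‖ (norm_nonneg a)).1.2
  refine ⟨integrableOn_cfc measurableSet_Ioi _ _ a hcont hbound hfin, ?_⟩
  rw [← cfc_setIntegral measurableSet_Ioi _ _ a hcont hbound hfin, CFC.rpow_eq_cfc_real ha]
  exact cfc_congr fun x hx => (hν x (hspec x hx).1).2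

end Power

/-! ### Operator tangents of the power function -/

section Tangent

open Set Real CFC ContinuousLinearMap

variable {ℬ : Type*} [CStarAlgebra ℬ]

/-- The continuous linear map `P ↦ E P + P E - E P F`. -/
noncomputable def mulAddMulSubMul (E F : ℬ) : ℬ →L[ℝ] ℬ :=
  mul ℝ ℬ E + (mul ℝ ℬ).flip E - mulLeftRight ℝ ℬ E F

lemma mulAddMulSubMul_apply (E F P : ℬ) : mulAddMulSubMul E F P = E * P + P * E - E * P * F := by
  simp [mulAddMulSubMul]

variable [PartialOrder ℬ] [StarOrderedRing ℬ]

/-- The factorisation `x ^ 2 = (x ^ 2 / (t + x)) * (t + x)` meets the condition of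
`PositiveLinearMap.mul_cfc_add_cfc_mul_le` with equality. -/
lemma rpow_mul_tangent_le {𝒜 : Type*} [CStarAlgebra 𝒜] [PartialOrder 𝒜] [StarOrderedRing 𝒜]
    (φ : 𝒜 →ₚ[ℂ] ℬ) {X : 𝒜} (hX : 0 ≤ X) {E : ℬ} (hE : IsSelfAdjoint E) (p : ℝ) {t : ℝ}
    (ht : 0 < t) :
    t ^ (p - 2) • (E * φ X + φ X * E - E * φ X * E - t • (E * φ 1 * E)) ≤
      φ (cfc (rpowIntegrand₁₂ p t) X) := by
  have hw : 0 ≤ t ^ (p - 2) := by positivity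
  have hcont : ContinuousOn (fun x : ℝ => x ^ 2 / (t + x)) (Ici 0) :=
    ContinuousOn.div (by fun_prop) (by fun_prop) fun x (hx : 0 ≤ x) => by positivity
  have h1 : cfc (rpowIntegrand₁₂ p t) X = t ^ (p - 2) • cfc (fun x : ℝ => x ^ 2 / (t + x)) X := by
    rw [← cfc_smul (t ^ (p - 2)) (fun x : ℝ => x ^ 2 / (t + x)) X
      (hcont.mono fun x hx => spectrum_nonneg_of_nonneg hX hx)]
    exact cfc_congr fun x hx =>
      rpowIntegrand₁₂_eq_rpow_mul_div ht (spectrum_nonneg_of_nonneg hX hx)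
  have h2 : cfc (fun x : ℝ => t + x) X = t • 1 + X := by
    rw [cfc_const_add t (fun x => x) X, cfc_id' ℝ X, Algebra.algebraMap_eq_smul_one]
  have key := φ.mul_cfc_add_cfc_mul_le hX hE hcont (g := fun x => x) (h := fun x => t + x)
    (by fun_prop) (by fun_prop) (fun x hx => by positivity) (fun x hx => by positivity)
    (fun x hx => by
      have : t + x ≠ 0 := by positivity
      field_simp; rfl)
  rw [h2, cfc_id' ℝ X, map_add, PositiveLinearMap.map_smul_of_tower] at key
  rw [h1, PositiveLinearMap.map_smul_of_tower]
  refine smul_le_smul_of_nonneg_left ?_ hw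
  rw [sub_sub, sub_le_iff_le_add]
  refine key.trans_eq ?_
  simp only [mul_add, add_mul, mul_smul_comm, smul_mul_assoc]
  abel

/-- The tangent of `rpowIntegrand₁₂ p t` at `Y` touches there. -/
lemma cfc_rpowIntegrand₁₂_eq_tangent {Y : ℬ} (hY : 0 ≤ Y) (p : ℝ) {t : ℝ} (ht : 0 < t) :
    let E : ℬ := cfc (fun x : ℝ => x / (t + x)) Y
    cfc (rpowIntegrand₁₂ p t) Y =
      t ^ (p - 2) • (E * Y + Y * E - E * Y * E - t • (E * 1 * E)) := by
  intro E
  have hYs : IsSelfAdjoint Y := .of_nonneg hY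
  have hspec : ∀ x ∈ spectrum ℝ Y, 0 ≤ x := fun x hx => spectrum_nonneg_of_nonneg hY hx
  have hc : ContinuousOn (fun x : ℝ => x / (t + x)) (spectrum ℝ Y) :=
    ContinuousOn.div (by fun_prop) (by fun_prop) fun x hx => by
      have := hspec x hx; positivity
  have h1 : E * Y = cfc (fun x : ℝ => x / (t + x) * x) Y := by
    rw [cfc_mul (fun x : ℝ => x / (t + x)) (fun x => x) Y hc, cfc_id' ℝ Y]
  have h2 : Y * E = cfc (fun x : ℝ => x * (x / (t + x))) Y := by
    rw [cfc_mul (fun x : ℝ => x) (fun x : ℝ => x / (t + x)) Y _ hc, cfc_id' ℝ Y]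
    fun_prop
  have h3 : E * Y * E = cfc (fun x : ℝ => x / (t + x) * x * (x / (t + x))) Y := by
    rw [h1, cfc_mul (fun x : ℝ => x / (t + x) * x) (fun x : ℝ => x / (t + x)) Y
      (hc.mul continuousOn_id) hc]
  have h4 : t • (E * 1 * E) =
      cfc (fun x : ℝ => t * (x / (t + x) * (x / (t + x)))) Y := by
    rw [mul_one, cfc_const_mul t (fun x : ℝ => x / (t + x) * (x / (t + x))) Y (hc.mul hc),
      cfc_mul (fun x : ℝ => x / (t + x)) (fun x : ℝ => x / (t + x)) Y hc hc]
  have hcx : ContinuousOn (fun x : ℝ => x / (t + x) * x) (spectrum ℝ Y) := hc.mul continuousOn_id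
  have hxc : ContinuousOn (fun x : ℝ => x * (x / (t + x))) (spectrum ℝ Y) :=
    continuousOn_id.mul hc
  have hcxc : ContinuousOn (fun x : ℝ => x / (t + x) * x * (x / (t + x))) (spectrum ℝ Y) :=
    hcx.mul hc
  have hcc : ContinuousOn (fun x : ℝ => t * (x / (t + x) * (x / (t + x)))) (spectrum ℝ Y) :=
    continuousOn_const.mul (hc.mul hc)
  rw [h3, h4, h1, h2, ← cfc_add (a := Y) _ _ hcx hxc, ← cfc_sub _ _ Y (hcx.fun_add hxc) hcxc,
    ← cfc_sub _ _ Y ((hcx.fun_add hxc).fun_sub hcxc) hcc,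
    ← cfc_smul _ _ Y (((hcx.fun_add hxc).fun_sub hcxc).fun_sub hcc)]
  refine cfc_congr fun x hx => ?_
  have h0 := hspec x hx
  have hne : t + x ≠ 0 := by positivity
  rw [rpowIntegrand₁₂_eq_rpow_mul_div ht h0]
  rw [smul_eq_mul]
  congr 1
  field_simp
  ring

/-- The integral representation stops short of exponent 2. There the tangent is explicit: expand `(X
- Y) ^ 2 ≥ 0` under `φ`. -/
lemma exists_tangent_rpow_two {Y : ℬ} (hY : 0 ≤ Y)
    (𝒜 : Type*) [CStarAlgebra 𝒜] [PartialOrder 𝒜] [StarOrderedRing 𝒜] :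
    ∃ S R : ℬ →L[ℝ] ℬ,
      (∀ (φ : 𝒜 →ₚ[ℂ] ℬ) (X : 𝒜), 0 ≤ X → S (φ X) - R (φ 1) ≤ φ (X ^ (2 : ℝ))) ∧
      ∀ Z : ℬ, Z ≤ 1 → Y ^ (2 : ℝ) ≤ S Y - R Z := by
  refine ⟨mul ℝ ℬ Y + (mul ℝ ℬ).flip Y, mulLeftRight ℝ ℬ Y Y, fun φ X hX => ?_, fun Z hZ => ?_⟩
  · have key := φ.mul_cfc_add_cfc_mul_le hX (IsSelfAdjoint.of_nonneg hY)
      (f := fun x => x ^ 2) (g := fun x => x) (h := fun _ => 1)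
      (by fun_prop) (by fun_prop) (by fun_prop) (fun x hx => by positivity)
      (fun x hx => by positivity) (fun x hx => by simp)
    rw [cfc_id' ℝ X, cfc_pow_id X 2, cfc_const_one ℝ X] at key
    have h2 : X ^ (2 : ℝ) = X ^ 2 := by exact_mod_cast CFC.rpow_natCast X 2 hX
    rw [h2, sub_le_iff_le_add]
    simpa using key
  · have h2 : Y ^ (2 : ℝ) = Y ^ 2 := by exact_mod_cast CFC.rpow_natCast Y 2 hY
    have := conjugate_le_conjugate_of_nonneg hZ hY
    rw [h2, le_sub_iff_add_le]
    simpa [sq] using this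

/-- Operator tangents of `x ^ p`: an affine minorant of `φ (X ^ p)` in terms of `φ X` and `φ 1`,
valid for all positive maps at once, and touching at `Y`. -/
theorem exists_tangent_rpow {p : ℝ} (hp : p ∈ Ioc 1 2) {Y : ℬ} (hY : 0 ≤ Y)
    (𝒜 : Type*) [CStarAlgebra 𝒜] [PartialOrder 𝒜] [StarOrderedRing 𝒜] :
    ∃ S R : ℬ →L[ℝ] ℬ,
      (∀ (φ : 𝒜 →ₚ[ℂ] ℬ) (X : 𝒜), 0 ≤ X → S (φ X) - R (φ 1) ≤ φ (X ^ p)) ∧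
      ∀ Z : ℬ, Z ≤ 1 → Y ^ p ≤ S Y - R Z := by
  rcases hp.2.eq_or_lt with rfl | hp2
  · exact exists_tangent_rpow_two hY 𝒜
  have hp' : p ∈ Ioo 1 2 := ⟨hp.1, hp2⟩
  obtain ⟨ν, hν⟩ := exists_measure_rpow_eq_integral_rpowIntegrand₁₂ hp'
  let E : ℝ → ℬ := fun t => cfc (fun x : ℝ => x / (t + x)) Y
  -- `W` carries the weight and is integrable; the other factors, `E t` and `t • E t`, are only
  -- bounded.
  let W : ℝ → ℬ := fun t => cfc (fun x : ℝ => t ^ (p - 2) * (x / (t + x))) Y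
  have hspec : ∀ x ∈ spectrum ℝ Y, 0 ≤ x ∧ x ≤ ‖Y‖ := fun x hx =>
    mem_Icc_norm_of_mem_spectrum hY hx
  have hEcont : ∀ t, 0 < t → ContinuousOn (fun x : ℝ => x / (t + x)) (spectrum ℝ Y) :=
    fun t ht => ContinuousOn.div (by fun_prop) (by fun_prop) fun x hx => by
      have := (hspec x hx).1; positivity
  have hWE : ∀ t, 0 < t → W t = t ^ (p - 2) • E t := fun t ht =>
    cfc_smul (t ^ (p - 2)) (fun x : ℝ => x / (t + x)) Y (hEcont t ht)
  have hE0 : ∀ t, 0 < t → 0 ≤ E t := fun t ht => cfc_nonneg fun x hx => by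
    have := (hspec x hx).1; positivity
  have hE1 : ∀ t, 0 < t → ‖E t‖ ≤ 1 := fun t ht => norm_cfc_le zero_le_one fun x hx => by
    have := (hspec x hx).1
    rw [Real.norm_of_nonneg (by positivity)]
    exact div_le_one_of_le₀ (by linarith) (by positivity)
  have hEY : ∀ t, 0 < t → ‖t • E t‖ ≤ ‖Y‖ := fun t ht => by
    rw [← cfc_smul t (fun x : ℝ => x / (t + x)) Y (hEcont t ht)]
    refine norm_cfc_le (norm_nonneg Y) fun x hx => ?_
    obtain ⟨h0, h1⟩ := hspec x hx
    rw [smul_eq_mul, Real.norm_of_nonneg (by positivity)]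
    refine le_trans ?_ h1
    rw [← mul_div_assoc, div_le_iff₀ (by positivity)]
    nlinarith
  have hWint : IntegrableOn W (Ioi 0) ν := by
    refine integrableOn_cfc measurableSet_Ioi _
      -- Since `x / (t + x) ≤ (1 + ‖Y‖) / (t + 1)` on the spectrum, the representation at `x = 1`
      -- supplies the dominating function.
      (fun t => (1 + ‖Y‖) * rpowIntegrand₁₂ p t 1) Y ?_ ?_ ?_
    · simp only [Function.uncurry_def]
      refine ContinuousOn.mul (ContinuousOn.rpow_const (by fun_prop) fun z hz => .inl hz.1.ne')
        (ContinuousOn.div (by fun_prop) (by fun_prop) fun z hz => ?_)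
      have h1 : 0 < z.1 := hz.1
      have h2 := (hspec _ hz.2).1
      positivity
    · filter_upwards [ae_restrict_mem measurableSet_Ioi] with t (ht : 0 < t) x hx
      obtain ⟨h0, h1⟩ := hspec x hx
      rw [rpowIntegrand₁₂_eq_rpow_mul_div ht zero_le_one, Real.norm_of_nonneg (by positivity),
        mul_left_comm]
      refine mul_le_mul_of_nonneg_left ?_ (by positivity)
      rw [one_pow, mul_one_div, div_le_div_iff₀ (by positivity) (by positivity)]
      nlinarith [mul_nonneg h0 (sub_nonneg.2 h1)]
    · exact (((hν 1 (by simp)).1).const_mul (1 + ‖Y‖)).2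
  have hEmeas : AEStronglyMeasurable E (ν.restrict (Ioi 0)) := by
    have hm : AEStronglyMeasurable (fun t : ℝ => t ^ (2 - p)) (ν.restrict (Ioi 0)) :=
      (by fun_prop : Measurable fun t : ℝ => t ^ (2 - p)).aestronglyMeasurable
    refine (hm.smul hWint.aestronglyMeasurable).congr ?_
    filter_upwards [ae_restrict_mem measurableSet_Ioi] with t (ht : 0 < t)
    rw [Pi.smul_apply', hWE t ht, smul_smul, ← Real.rpow_add ht]
    simp
  have hmLR : ∀ F : ℝ → ℬ, AEStronglyMeasurable F (ν.restrict (Ioi 0)) →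
      (∀ t, 0 < t → ‖F t‖ ≤ 1 + ‖Y‖) →
      IntegrableOn (fun t => mulLeftRight ℝ ℬ (W t) (F t)) (Ioi 0) ν := by
    intro F hF hb
    refine Integrable.mono' (hWint.norm.mul_const (1 + ‖Y‖))
      ((mulLeftRight ℝ ℬ).aestronglyMeasurable_comp₂ hWint.aestronglyMeasurable hF) ?_
    filter_upwards [ae_restrict_mem measurableSet_Ioi] with t (ht : 0 < t)
    exact (opNorm_mulLeftRight_apply_apply_le ℝ ℬ _ _).trans
      (mul_le_mul_of_nonneg_left (hb t ht) (norm_nonneg _))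
  have hSint : IntegrableOn (fun t => mulAddMulSubMul (W t) (E t)) (Ioi 0) ν :=
    (((mul ℝ ℬ).integrable_comp hWint).add ((mul ℝ ℬ).flip.integrable_comp hWint)).sub
      (hmLR E hEmeas fun t ht => (hE1 t ht).trans (by simp))
  have hRint : IntegrableOn (fun t => mulLeftRight ℝ ℬ (W t) (t • E t)) (Ioi 0) ν :=
    hmLR (fun t => t • E t) (aestronglyMeasurable_id.smul hEmeas)
      fun t ht => (hEY t ht).trans (by simp)
  have happly : ∀ P Q : ℬ,
      IntegrableOn (fun t => mulAddMulSubMul (W t) (E t) P - mulLeftRight ℝ ℬ (W t) (t • E t) Q)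
        (Ioi 0) ν ∧
      (∫ t in Ioi 0, mulAddMulSubMul (W t) (E t) ∂ν) P -
        (∫ t in Ioi 0, mulLeftRight ℝ ℬ (W t) (t • E t) ∂ν) Q =
      ∫ t in Ioi 0, (mulAddMulSubMul (W t) (E t) P - mulLeftRight ℝ ℬ (W t) (t • E t) Q) ∂ν := by
    intro P Q
    have h1 := hSint.apply_continuousLinearMap P
    have h2 := hRint.apply_continuousLinearMap Q
    refine ⟨h1.sub h2, ?_⟩
    rw [integral_sub h1 h2, ContinuousLinearMap.integral_apply hSint,
      ContinuousLinearMap.integral_apply hRint]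
  have hval : ∀ t, 0 < t → ∀ P Q : ℬ,
      mulAddMulSubMul (W t) (E t) P - mulLeftRight ℝ ℬ (W t) (t • E t) Q =
        t ^ (p - 2) • (E t * P + P * E t - E t * P * E t - t • (E t * Q * E t)) := by
    intro t ht P Q
    simp only [mulAddMulSubMul_apply, mulLeftRight_apply, hWE t ht, smul_mul_assoc, mul_smul_comm,
      smul_sub, smul_add, smul_comm t]
  refine ⟨∫ t in Ioi 0, mulAddMulSubMul (W t) (E t) ∂ν,
    ∫ t in Ioi 0, mulLeftRight ℝ ℬ (W t) (t • E t) ∂ν, fun φ X hX => ?_, fun Z hZ => ?_⟩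
  · obtain ⟨hi, he⟩ := CFC.rpow_eq_setIntegral_cfc_rpowIntegrand₁₂ hp' hν hX
    let φ' : 𝒜 →L[ℝ] ℬ := (⟨φ.toLinearMap, map_continuous φ⟩ : 𝒜 →L[ℂ] ℬ).restrictScalars ℝ
    have h3 : φ (X ^ p) = ∫ t in Ioi 0, φ' (cfc (rpowIntegrand₁₂ p t) X) ∂ν := by
      rw [φ'.integral_comp_comm hi, ← he]; rfl
    rw [(happly _ _).2, h3]
    refine setIntegral_mono_on (happly _ _).1 (φ'.integrable_comp hi) measurableSet_Ioi
      fun t (ht : 0 < t) => ?_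
    rw [hval t ht]
    exact rpow_mul_tangent_le φ hX (.of_nonneg (hE0 t ht)) p ht
  · obtain ⟨hi, he⟩ := CFC.rpow_eq_setIntegral_cfc_rpowIntegrand₁₂ hp' hν hY
    rw [(happly _ _).2, he]
    refine setIntegral_mono_on hi (happly _ _).1 measurableSet_Ioi fun t (ht : 0 < t) => ?_
    rw [hval t ht]
    have hle : t • (E t * Z * E t) ≤ t • (E t * 1 * E t) :=
      smul_le_smul_of_nonneg_left (conjugate_le_conjugate_of_nonneg hZ (hE0 t ht)) ht.le
    rw [cfc_rpowIntegrand₁₂_eq_tangent hY p ht]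
    exact smul_le_smul_of_nonneg_left (sub_le_sub_left hle _) (by positivity)

end Tangent

/-! ### Integration over the field -/

/-- A nonnegative function whose extended negative power has finite integral is positive almost
everywhere, and its real negative power is integrable. -/
lemma ae_pos_and_integrable_rpow_of_lintegral_lt_top {T : Type*} [MeasurableSpace T]
    {μ : Measure T} {a : T → ℝ} (ha : Measurable a) (ha0 : ∀ t, 0 ≤ a t) {q : ℝ} (hq : q < 0)
    (hfin : ∫⁻ t, ENNReal.ofReal (a t) ^ q ∂μ < ∞) :
    (∀ᵐ t ∂μ, 0 < a t) ∧ Integrable (fun t => a t ^ q) μ := by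
  have hm : Measurable fun t => ENNReal.ofReal (a t) ^ q := by fun_prop
  have hpos : ∀ᵐ t ∂μ, 0 < a t := by
    filter_upwards [ae_lt_top hm hfin.ne] with t ht
    refine (ha0 t).lt_of_ne fun h => ?_
    rw [← h, ENNReal.ofReal_zero, ENNReal.zero_rpow_of_neg hq] at ht
    exact lt_irrefl _ ht
  refine ⟨hpos, (by fun_prop : Measurable fun t => a t ^ q).aestronglyMeasurable, ?_⟩
  rw [hasFiniteIntegral_iff_ofReal (.of_forall fun t => Real.rpow_nonneg (ha0 t) q)]
  refine lt_of_eq_of_lt (lintegral_congr_ae ?_) hfin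
  filter_upwards [hpos] with t ht
  rw [ENNReal.ofReal_rpow_of_pos ht]

/-- The elementary bound `x ≤ 1 + x ^ r` for nonnegative elements. -/
lemma CFC.le_one_add_rpow {A : Type*} [CStarAlgebra A] [PartialOrder A] [StarOrderedRing A]
    {r : ℝ} (hr : 1 ≤ r) {X : A} (hX : 0 ≤ X) : X ≤ 1 + X ^ r := by
  have hc : Continuous fun x : ℝ => x ^ r := Real.continuous_rpow_const (by linarith)
  rw [CFC.rpow_eq_cfc_real hX]
  conv_lhs => rw [← cfc_id' ℝ X]
  rw [← cfc_const_one ℝ X, ← cfc_add (a := X) (fun _ : ℝ => (1 : ℝ)) (fun x : ℝ => x ^ r)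
    continuousOn_const hc.continuousOn]
  refine cfc_mono (fun x hx => ?_) continuousOn_id (continuousOn_const.add hc.continuousOn)
  have h0 := spectrum_nonneg_of_nonneg hX hx
  rcases le_total x 1 with h | h
  · linarith [Real.rpow_nonneg h0 r]
  · linarith [Real.self_le_rpow_of_one_le h hr]

/-- `A t ^ r` is the continuous functional calculus power. The integral of `a ^ (1 / (1 - r))` is
assumed finite with the convention `0 ^ (1 / (1 - r)) = ∞` (which is that of `ℝ≥0∞`); in particular
the zeros of `a` form a `μ`-null set, so that the value of the real power at them is immaterial.
The Bochner integrals of the claim are assumed to exist, except the one on the left, for which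
only measurability of the integrand is assumed and integrability is part of the conclusion. -/
theorem mainTheorem1
    {T : Type*} [TopologicalSpace T] [T2Space T] [LocallyCompactSpace T]
    [MeasurableSpace T] [BorelSpace T]
    (μ : Measure T) [IsFiniteMeasure μ] [μ.Regular]
    {𝒜 : Type*} [CStarAlgebra 𝒜] [PartialOrder 𝒜] [StarOrderedRing 𝒜]
    {ℬ : Type*} [CStarAlgebra ℬ] [PartialOrder ℬ] [StarOrderedRing ℬ]
    (r : ℝ) (hr1 : 1 < r) (hr2 : r ≤ 2)
    (a : T → ℝ) (ha_cont : Continuous a) (ha_nonneg : ∀ t, 0 ≤ a t)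
    (ha_bdd : ∃ C : ℝ, ∀ t, a t ≤ C)
    (ha_fin : ∫⁻ t, ENNReal.ofReal (a t) ^ (1 / (1 - r)) ∂μ < ∞)
    (φ : T → 𝒜 →ₚ[ℂ] ℬ)
    (hφ_int : Integrable (fun t => a t ^ (1 / (1 - r)) • φ t 1) μ)
    (hφ_le : ∫ t, a t ^ (1 / (1 - r)) • φ t 1 ∂μ ≤
      (∫ t, a t ^ (1 / (1 - r)) ∂μ) • (1 : ℬ)) :
    ∀ A : T → 𝒜, Continuous A → (∀ t, 0 ≤ A t) →
      AEStronglyMeasurable (fun t => φ t (A t)) μ →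
      Integrable (fun t => a t • φ t (A t ^ r)) μ →
      Integrable (fun t => φ t (A t)) μ ∧
        (∫ t, φ t (A t) ∂μ) ^ r ≤
          (∫ t, a t ^ (1 / (1 - r)) ∂μ) ^ (r - 1) • ∫ t, a t • φ t (A t ^ r) ∂μ := by
  intro A _ hA hmeas hint
  have hq : 1 / (1 - r) < 0 := div_neg_of_pos_of_neg one_pos (by linarith)
  obtain ⟨hpos, hb⟩ :=
    ae_pos_and_integrable_rpow_of_lintegral_lt_top ha_cont.measurable ha_nonneg hq ha_fin
  have hr' : 1 - r ≠ 0 := by linarith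
  -- Rescaling `A t` turns the weighted inequality into one for the weights `a t ^ (1 / (1 - r))`.
  have hbc : ∀ t, 0 < a t → a t ^ (1 / (1 - r)) * a t ^ (-(1 / (1 - r))) = 1 := fun t ht => by
    rw [← Real.rpow_add ht, add_neg_cancel, Real.rpow_zero]
  -- The exponent `q = 1 / (1 - r)` is the solution of `q - q * r = 1`.
  have hbcr : ∀ t, 0 < a t →
      a t ^ (1 / (1 - r)) * (a t ^ (-(1 / (1 - r)))) ^ r = a t := fun t ht => by
    rw [← Real.rpow_mul ht.le, ← Real.rpow_add ht]
    conv_rhs => rw [← Real.rpow_one (a t)]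
    congr 1
    field_simp
    ring
  have hscale : ∀ t, 0 < a t →
      a t ^ (1 / (1 - r)) • φ t (a t ^ (-(1 / (1 - r))) • A t) = φ t (A t) ∧
      a t ^ (1 / (1 - r)) • φ t ((a t ^ (-(1 / (1 - r))) • A t) ^ r) = a t • φ t (A t ^ r) := by
    intro t ht
    rw [CFC.smul_rpow_of_nonneg (hA t) (by positivity) (by linarith),
      PositiveLinearMap.map_smul_of_tower, PositiveLinearMap.map_smul_of_tower, smul_smul,
      smul_smul, hbc t ht, hbcr t ht, one_smul]
    exact ⟨rfl, rfl⟩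
  -- Applying `x ≤ 1 + x ^ r` to the rescaled element dominates the integrand by the two given
  -- integrable ones.
  have hφA : Integrable (fun t => φ t (A t)) μ := by
    refine (hφ_int.norm.add hint.norm).mono' hmeas ?_
    filter_upwards [hpos] with t ht
    have hX : 0 ≤ a t ^ (-(1 / (1 - r))) • A t := smul_nonneg (by positivity) (hA t)
    have h1 : φ t (A t) ≤ a t ^ (1 / (1 - r)) • φ t 1 + a t • φ t (A t ^ r) := by
      rw [← (hscale t ht).2, ← smul_add, ← map_add, ← (hscale t ht).1]
      exact smul_le_smul_of_nonneg_left
        (OrderHomClass.mono (φ t) (CFC.le_one_add_rpow hr1.le hX)) (by positivity)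
    exact (CStarAlgebra.norm_le_norm_of_nonneg_of_le ((φ t).map_nonneg (hA t)) h1).trans
      (norm_add_le _ _)
  refine ⟨hφA, ?_⟩
  rcases eq_or_ne μ 0 with rfl | hμ
  · simp only [integral_zero_measure, smul_zero]
    exact (CFC.zero_rpow (by linarith : r ≠ 0)).le
  set w : ℝ := ∫ t, a t ^ (1 / (1 - r)) ∂μ
  have hw0 : 0 < w := by
    refine (integral_pos_iff_support_of_nonneg (fun t => Real.rpow_nonneg (ha_nonneg t) _) hb).2 ?_
    refine (pos_iff_ne_zero.2 (Measure.measure_univ_ne_zero.2 hμ)).trans_le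
      (measure_mono_ae ?_)
    filter_upwards [hpos] with t ht _
    exact (Real.rpow_pos_of_pos ht _).ne'
  set J : ℬ := ∫ t, φ t (A t) ∂μ
  have hJ : 0 ≤ J := integral_nonneg fun t => (φ t).map_nonneg (hA t)
  have hY : 0 ≤ w⁻¹ • J := smul_nonneg (by positivity) hJ
  -- `S` and `R` depend on the mean but not on `t`, so they commute with the integral over `T`.
  obtain ⟨S, R, hSR, hYr⟩ := exists_tangent_rpow (p := r) ⟨hr1, hr2⟩ hY 𝒜
  have hZ : w⁻¹ • ∫ t, a t ^ (1 / (1 - r)) • φ t 1 ∂μ ≤ 1 := by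
    simpa [smul_smul, hw0.ne'] using
      smul_le_smul_of_nonneg_left hφ_le (inv_nonneg.2 hw0.le)
  have hmain : S J - R (∫ t, a t ^ (1 / (1 - r)) • φ t 1 ∂μ) ≤ ∫ t, a t • φ t (A t ^ r) ∂μ := by
    rw [← S.integral_comp_comm hφA, ← R.integral_comp_comm hφ_int,
      ← integral_sub (S.integrable_comp hφA) (R.integrable_comp hφ_int)]
    refine integral_mono_ae ((S.integrable_comp hφA).sub (R.integrable_comp hφ_int)) hint ?_
    filter_upwards [hpos] with t ht
    have hX : 0 ≤ a t ^ (-(1 / (1 - r))) • A t := smul_nonneg (by positivity) (hA t)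
    have := smul_le_smul_of_nonneg_left (hSR (φ t) _ hX)
      (Real.rpow_nonneg (ha_nonneg t) (1 / (1 - r)))
    rwa [smul_sub, ← map_smul S, ← map_smul R, (hscale t ht).1, (hscale t ht).2] at this
  have hJr : J ^ r = w ^ r • (w⁻¹ • J) ^ r := by
    rw [← CFC.smul_rpow_of_nonneg hY hw0.le (by linarith), smul_smul, mul_inv_cancel₀ hw0.ne',
      one_smul]
  calc J ^ r = w ^ r • (w⁻¹ • J) ^ r := hJr
    _ ≤ w ^ r • (S (w⁻¹ • J) - R (w⁻¹ • ∫ t, a t ^ (1 / (1 - r)) • φ t 1 ∂μ)) :=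
      smul_le_smul_of_nonneg_left (hYr _ hZ) (by positivity)
    _ = w ^ (r - 1) • (S J - R (∫ t, a t ^ (1 / (1 - r)) • φ t 1 ∂μ)) := by
      rw [map_smul, map_smul, ← smul_sub, smul_smul, Real.rpow_sub_one hw0.ne',
        div_eq_mul_inv (w ^ r)]
    _ ≤ w ^ (r - 1) • ∫ t, a t • φ t (A t ^ r) ∂μ :=
      smul_le_smul_of_nonneg_left hmain (by positivity)
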